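/- Let $d$ be the dimension, let $u:\mathbb R^d\to\mathbb R$ (functions are considered up to equality almost everywhere) and put $u_h(x)=u(x+h)$ for $h\in\mathbb R^d$. For an integer $k\ge 0$ and $\gamma\in(0,1)$ let $N^{k+\gamma}_2(\mathbb R^d)$ be the Nikolskii space of all $v$ in the Sobolev space $W^k_2(\mathbb R^d)$ with $$\|v\|_{N^{k+\gamma}_2(\mathbb R^d)}=\Big(\sum_{|\alpha|\le k}\|\partial^\alpha v\|_{L_2(\mathbb R^d)}^2\Big)^{1/2}+\max_{|\alpha|=k}\ \sup_{h\ne 0}\frac{\|(\partial^\alpha v)_h-\partial^\alpha v\|_{L_2(\mathbb R^d)}}{|h|^{\gamma}}<\infty ,$$ where $\partial^\alpha v$ are weak derivatives, and let $H^1(\mathbb R^d)=W^1_2(\mathbb R^d)$ with the norm $\|v\|_{H^1}=\big(\sum_{|\alpha|\le 1}\|\partial^\alpha v\|_{L_2}^2\big)^{1/2}$. Then the following holds. 1. If $0<\gamma_1<\gamma_2<1$, there is a constant $C$, depending only on $d,\gamma_1,\gamma_2$, such that for all $u\in N^{\gamma_2}_2(\mathbb R^d)$ and $h\in\mathbb R^d$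 one has $u-u_h\in N^{\gamma_1}_2(\mathbb R^d)$ and $$\|u-u_h\|_{N^{\gamma_1}_2(\mathbb R^d)}\le C\,|h|^{\gamma_2-\gamma_1}\,\|u\|_{N^{\gamma_2}_2(\mathbb R^d)}.$$ 2. If $0<\gamma_1<1$, there is a constant $C$, depending only on $d,\gamma_1$, such that for all $u\in H^1(\mathbb R^d)$ and $h\in\mathbb R^d$ one has $u-u_h\in N^{\gamma_1}_2(\mathbb R^d)$ and $$\|u-u_h\|_{N^{\gamma_1}_2(\mathbb R^d)}\le C\,|h|^{1-\gamma_1}\,\|u\|_{H^1(\mathbb R^d)}.$$ 3. If $0<\gamma_1<\gamma_1+\gamma_2\le 1$, there is a constant $C$, depending only on $d,\gamma_1,\gamma_2$, such that for all $u\in N^{1+\gamma_2}_2(\mathbb R^d)$ and $h\in\mathbb R^d$ one has $u-u_h\in N^{1-\gamma_1}_2(\mathbb R^d)$ and $$\|u-u_h\|_{N^{1-\gamma_1}_2(\mathbb R^d)}\le C\,|h|^{\gamma_1+\gamma_2}\,\|u\|_{N^{1+\gamma_2}_2(\mathbb R^d)}.$$ -/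

import Mathlib

open MeasureTheory
open scoped ENNReal ContDiff

noncomputable section

namespace Nikolskii

/-- The space `ℝ^d` with its Euclidean norm and Lebesgue measure. -/
abbrev E (d : ℕ) : Type := EuclideanSpace ℝ (Fin d)

/-- The translate `v_h(x) = v(x + h)`. -/
def shift {d : ℕ} (h : E d) (v : E d → ℝ) : E d → ℝ := fun x => v (x + h)

/-- The classical partial derivative `∂_i φ`. -/
def partialDeriv {d : ℕ} (i : Fin d) (φ : E d → ℝ) : E d → ℝ :=
  fun x => fderiv ℝ φ x (EuclideanSpace.single i 1)

/-- The classical mixed partial derivative `∂^α φ = ∂_1^{α_1} ⋯ ∂_d^{α_d} φ` of a smooth `φ`. -/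
def multiDeriv {d : ℕ} (α : Fin d → ℕ) (φ : E d → ℝ) : E d → ℝ :=
  (List.finRange d).foldr (fun i ψ => (partialDeriv i)^[α i] ψ) φ

/-- `g` is a weak partial derivative `∂^α u` on `ℝ^d`. -/
def HasWeakDeriv {d : ℕ} (α : Fin d → ℕ) (u g : E d → ℝ) : Prop :=
  LocallyIntegrable u volume ∧ LocallyIntegrable g volume ∧
    ∀ φ : E d → ℝ, ContDiff ℝ ∞ φ → HasCompactSupport φ →
      ∫ x, u x * multiDeriv α φ x = (-1 : ℝ) ^ (∑ i, α i) * ∫ x, g x * φ x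

open Classical in
/-- A representative of the weak derivative `∂^α u`, which is unique up to null sets
(and `0` if there is no weak derivative). -/
def weakDeriv {d : ℕ} (α : Fin d → ℕ) (u : E d → ℝ) : E d → ℝ :=
  if h : ∃ g, HasWeakDeriv α u g then h.choose else 0

/-- `u ∈ W^k_p(ℝ^d)`: `u` and its weak derivatives of order at most `k` are in `L_p`. -/
def MemSobolev {d : ℕ} (k : ℕ) (p : ℝ≥0∞) (u : E d → ℝ) : Prop :=
  MemLp u p volume ∧
    ∀ α : Fin d → ℕ, ∑ i, α i ≤ k → ∃ g, HasWeakDeriv α u g ∧ MemLp g p volume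

/-- The norm of `W^k_p(ℝ^d)`: `(∑_{|α| ≤ k} ‖∂^α u‖_{L_p}^p)^{1/p}`, and
`max_{|α| ≤ k} ‖∂^α u‖_{L_∞}` for `p = ∞`. The set `piAntidiag univ j` consists of the
multi-indices `α` with `|α| = j`. -/
def sobolevNorm {d : ℕ} (k : ℕ) (p : ℝ≥0∞) (u : E d → ℝ) : ℝ≥0∞ :=
  if p = ⊤ then
    ⨆ (α : Fin d → ℕ) (_ : ∑ i, α i ≤ k), eLpNorm (weakDeriv α u) ⊤ volume
  else
    (∑ j ∈ Finset.range (k + 1), ∑ α ∈ Finset.piAntidiag (Finset.univ : Finset (Fin d)) j,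
      eLpNorm (weakDeriv α u) p volume ^ p.toReal) ^ (1 / p.toReal)

/-- The seminorm `[v]_{N^{k+γ}_p(ℝ^d)}` for `γ ∈ (0,1]`, through first differences if `γ < 1`
and second differences if `γ = 1`. -/
def nikolskiiSeminorm {d : ℕ} (k : ℕ) (γ : ℝ) (p : ℝ≥0∞) (v : E d → ℝ) : ℝ≥0∞ :=
  if γ = 1 then
    ⨆ (α : Fin d → ℕ) (_ : ∑ i, α i = k) (h : E d) (_ : h ≠ 0),
      eLpNorm (shift ((2 : ℝ) • h) (weakDeriv α v) - (2 : ℝ) • shift h (weakDeriv α v)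
        + weakDeriv α v) p volume / ENNReal.ofReal ‖h‖
  else
    ⨆ (α : Fin d → ℕ) (_ : ∑ i, α i = k) (h : E d) (_ : h ≠ 0),
      eLpNorm (shift h (weakDeriv α v) - weakDeriv α v) p volume / ENNReal.ofReal (‖h‖ ^ γ)

/-- The norm of the Nikolskii space `N^{k+γ}_p(ℝ^d)`. -/
def nikolskiiNorm {d : ℕ} (k : ℕ) (γ : ℝ) (p : ℝ≥0∞) (v : E d → ℝ) : ℝ≥0∞ :=
  sobolevNorm k p v + nikolskiiSeminorm k γ p v

/-- `v ∈ N^{k+γ}_p(ℝ^d)`. -/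
def MemNikolskii {d : ℕ} (k : ℕ) (γ : ℝ) (p : ℝ≥0∞) (v : E d → ℝ) : Prop :=
  MemSobolev k p v ∧ nikolskiiNorm k γ p v < ⊤

end Nikolskii

end

noncomputable section

namespace Nikolskii

/-! With `D_h u = u_h - u`, an increment of `u - u_h` is, up to sign, the second difference `D_k D_h
u = D_h D_k u`, and each step of it can be estimated in either order. In every case the supremum
over `k` is split at `‖k‖ = ‖h‖`.

For the first two claims, one difference is bounded by the regularity of `u` and the other by the
triangle inequality, keeping the smaller of the two steps (`memNikolskii_sub_shift`). In the `H¹`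
case the regularity is `‖D_h u‖₂ ≤ d ‖h‖ max ‖∂_i u‖₂` (`eLpNorm_shift_sub_le_of_hasWeakDeriv`),
proved by duality with test functions.

For the third, that estimate applied to `D_h u`, whose gradient is `D_h ∇u`, gives the bound `d ‖k‖
‖h‖ ^ γ₂ N`, where `N` is the norm of `u`; the steps may be swapped
(`memNikolskii_sub_shift_of_gradient`). -/

variable {d : ℕ}

/-! ### ### Duality in `L₂` and translations -/

/-- A bound on the pairings of `w ∈ L₂` with smooth compactly supported functions bounds `‖w‖₂`. -/
theorem eLpNorm_le_of_forall_contDiff_integral_mul_le {w : E d → ℝ} (hw : MemLp w 2 volume)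
    {M : ℝ} (hM : 0 ≤ M)
    (H : ∀ φ : E d → ℝ, ContDiff ℝ ∞ φ → HasCompactSupport φ →
      |∫ x, w x * φ x| ≤ M * (eLpNorm φ 2 volume).toReal) :
    eLpNorm w 2 volume ≤ ENNReal.ofReal M := by
  have key : ∀ f : Lp ℝ 2 (volume : Measure (E d)), |inner ℝ (hw.toLp w) f| ≤ M * ‖f‖ := by
    have hd := Lp.dense_hasCompactSupport_contDiff (F := ℝ) (μ := (volume : Measure (E d)))
      (p := 2) (by norm_num)
    refine fun f => hd.induction (P := fun f => |inner ℝ (hw.toLp w) f| ≤ M * ‖f‖) ?_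
      (isClosed_le (by fun_prop) (by fun_prop)) f
    rintro f ⟨φ, hfφ, hφc, hφ⟩
    have h1 : inner ℝ (hw.toLp w) f = ∫ x, w x * φ x := by
      rw [L2.inner_def]
      refine integral_congr_ae ?_
      filter_upwards [hfφ, hw.coeFn_toLp] with x h1 h2
      simp [h1, h2, mul_comm]
    rw [h1, Lp.norm_def, eLpNorm_congr_ae hfφ]
    exact H φ hφ hφc
  -- Testing against `w` itself gives `‖w‖² ≤ M ‖w‖`.
  have h := key (hw.toLp w)
  rw [real_inner_self_eq_norm_sq, abs_of_nonneg (sq_nonneg _)] at h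
  have h2 : ‖hw.toLp w‖ ≤ M := by
    by_contra! hlt
    nlinarith [norm_nonneg (hw.toLp w)]
  rw [Lp.norm_toLp] at h2
  exact (ENNReal.le_ofReal_iff_toReal_le hw.eLpNorm_ne_top hM).2 h2

/-- The Cauchy–Schwarz inequality in `L₂`. -/
theorem abs_integral_mul_le_eLpNorm_mul_eLpNorm {f g : E d → ℝ}
    (hf : MemLp f 2 volume) (hg : MemLp g 2 volume) :
    |∫ x, f x * g x| ≤ (eLpNorm f 2 volume).toReal * (eLpNorm g 2 volume).toReal := by
  have h := abs_real_inner_le_norm (hf.toLp f) (hg.toLp g)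
  rw [Lp.norm_toLp, Lp.norm_toLp, L2.inner_def] at h
  convert! h using 2
  refine integral_congr_ae ?_
  filter_upwards [hf.coeFn_toLp, hg.coeFn_toLp] with x h1 h2
  simp [h1, h2, mul_comm]

theorem measurePreserving_shift (h : E d) :
    MeasurePreserving (fun x : E d => x + h) volume volume :=
  measurePreserving_add_right volume h

theorem eLpNorm_shift {v : E d → ℝ} {p : ℝ≥0∞} (hv : AEStronglyMeasurable v volume) (h : E d) :
    eLpNorm (shift h v) p volume = eLpNorm v p volume :=
  eLpNorm_comp_measurePreserving hv (measurePreserving_shift h)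

theorem memLp_shift {v : E d → ℝ} {p : ℝ≥0∞} (hv : MemLp v p volume) (h : E d) :
    MemLp (shift h v) p volume :=
  hv.comp_measurePreserving (measurePreserving_shift h)

theorem shift_ae_eq {v w : E d → ℝ} (hvw : v =ᵐ[volume] w) (h : E d) :
    shift h v =ᵐ[volume] shift h w :=
  (measurePreserving_shift h).quasiMeasurePreserving.ae_eq_comp hvw

/-! ### Classical derivatives of test functions -/

theorem contDiff_partialDeriv (i : Fin d) {φ : E d → ℝ} (hφ : ContDiff ℝ ∞ φ) :
    ContDiff ℝ ∞ (partialDeriv i φ) :=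
  (hφ.fderiv_right (by simp)).clm_apply contDiff_const

theorem hasCompactSupport_partialDeriv (i : Fin d) {φ : E d → ℝ} (hφ : HasCompactSupport φ) :
    HasCompactSupport (partialDeriv i φ) :=
  hφ.fderiv_apply (𝕜 := ℝ) _

theorem partialDeriv_shift (i : Fin d) (h : E d) (φ : E d → ℝ) :
    partialDeriv i (shift h φ) = shift h (partialDeriv i φ) := by
  funext x
  exact congrArg (fun T : E d →L[ℝ] ℝ => T (EuclideanSpace.single i 1))
    (fderiv_comp_add_right (𝕜 := ℝ) (f := φ) (x := x) h)

/-- A property that is stable under the partial derivatives is stable under `∂^α`. -/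
theorem multiDeriv_induction {P : (E d → ℝ) → Prop}
    (hP : ∀ i φ, P φ → P (partialDeriv i φ)) (α : Fin d → ℕ) {φ : E d → ℝ} (hφ : P φ) :
    P (multiDeriv α φ) := by
  unfold multiDeriv
  induction List.finRange d with
  | nil => exact hφ
  | cons i l ih => exact Function.Iterate.rec P ih (fun ψ hψ => hP i ψ hψ) (α i)

theorem contDiff_multiDeriv (α : Fin d → ℕ) {φ : E d → ℝ} (hφ : ContDiff ℝ ∞ φ) :
    ContDiff ℝ ∞ (multiDeriv α φ) :=
  multiDeriv_induction (fun i _ h => contDiff_partialDeriv i h) α hφ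

theorem hasCompactSupport_multiDeriv (α : Fin d → ℕ) {φ : E d → ℝ} (hφ : HasCompactSupport φ) :
    HasCompactSupport (multiDeriv α φ) :=
  multiDeriv_induction (fun i _ h => hasCompactSupport_partialDeriv i h) α hφ

theorem multiDeriv_shift (α : Fin d → ℕ) (h : E d) (φ : E d → ℝ) :
    multiDeriv α (shift h φ) = shift h (multiDeriv α φ) := by
  unfold multiDeriv
  induction List.finRange d with
  | nil => rfl
  | cons i l ih =>
    rw [List.foldr_cons, List.foldr_cons, ih]
    exact ((show Function.Semiconj (shift h) (partialDeriv i) (partialDeriv i) from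
      fun ψ => (partialDeriv_shift i h ψ).symm).iterate_right (α i) _).symm

theorem multiDeriv_zero (φ : E d → ℝ) : multiDeriv 0 φ = φ := by
  simp [multiDeriv]

theorem multiDeriv_single (i : Fin d) (φ : E d → ℝ) :
    multiDeriv (Pi.single i 1) φ = partialDeriv i φ := by
  unfold multiDeriv
  have hnd := List.nodup_finRange d
  have hi := List.mem_finRange i
  -- Off `i` every factor of the fold is a zeroth iterate; `i` occurs exactly once in `List.finRange
  -- d`, hence the need for `Nodup`.
  have hnot : ∀ l : List (Fin d), i ∉ l →
      l.foldr (fun j ψ => (partialDeriv j)^[(Pi.single i 1 : Fin d → ℕ) j] ψ) φ = φ := by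
    intro l hl
    induction l with
    | nil => rfl
    | cons j l ih =>
      rw [List.mem_cons, not_or] at hl
      rw [List.foldr_cons, ih hl.2, Pi.single_eq_of_ne (Ne.symm hl.1)]
      rfl
  revert hnd hi
  induction List.finRange d with
  | nil => simp
  | cons j l ih =>
    intro hnd hi
    rw [List.nodup_cons] at hnd
    rw [List.foldr_cons]
    rcases eq_or_ne i j with rfl | hij
    · rw [hnot l hnd.1]
      simp
    · rw [ih hnd.2 (by simpa [hij] using hi), Pi.single_eq_of_ne hij.symm]
      rfl

/-! ### Weak derivatives -/

theorem integrable_mul_of_hasCompactSupport {u φ : E d → ℝ} (hu : LocallyIntegrable u volume)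
    (hφ : Continuous φ) (hc : HasCompactSupport φ) : Integrable (fun x => u x * φ x) volume :=
  hu.integrable_smul_right_of_hasCompactSupport hφ hc

theorem HasWeakDeriv.ae_eq {α : Fin d → ℕ} {u g g' : E d → ℝ} (hg : HasWeakDeriv α u g)
    (hg' : HasWeakDeriv α u g') : g =ᵐ[volume] g' := by
  refine ae_eq_of_integral_contDiff_smul_eq hg.2.1 hg'.2.1 fun φ hφ hc => ?_
  have h := (hg.2.2 φ hφ hc).symm.trans (hg'.2.2 φ hφ hc)
  have h2 := mul_left_cancel₀ (pow_ne_zero _ (by norm_num)) h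
  simpa only [smul_eq_mul, mul_comm] using h2

/-- Since `weakDeriv` is an arbitrary choice, norms are computed by passing to a concrete
representative through this equality. -/
theorem HasWeakDeriv.weakDeriv_ae_eq {α : Fin d → ℕ} {u g : E d → ℝ} (hg : HasWeakDeriv α u g) :
    weakDeriv α u =ᵐ[volume] g := by
  have hex : ∃ g, HasWeakDeriv α u g := ⟨g, hg⟩
  rw [weakDeriv, dif_pos hex]
  exact hex.choose_spec.ae_eq hg

theorem hasWeakDeriv_zero {u : E d → ℝ} (hu : LocallyIntegrable u volume) :
    HasWeakDeriv 0 u u :=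
  ⟨hu, hu, fun φ _ _ => by simp [multiDeriv_zero]⟩

theorem HasWeakDeriv.sub {α : Fin d → ℕ} {u v f g : E d → ℝ} (hu : HasWeakDeriv α u f)
    (hv : HasWeakDeriv α v g) : HasWeakDeriv α (u - v) (f - g) := by
  refine ⟨hu.1.sub hv.1, hu.2.1.sub hv.2.1, fun φ hφ hc => ?_⟩
  have hφ' := (contDiff_multiDeriv α hφ).continuous
  have hc' := hasCompactSupport_multiDeriv α hc
  simp only [Pi.sub_apply, sub_mul]
  rw [integral_sub (integrable_mul_of_hasCompactSupport hu.1 hφ' hc')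
      (integrable_mul_of_hasCompactSupport hv.1 hφ' hc'),
    integral_sub (integrable_mul_of_hasCompactSupport hu.2.1 hφ.continuous hc)
      (integrable_mul_of_hasCompactSupport hv.2.1 hφ.continuous hc),
    hu.2.2 φ hφ hc, hv.2.2 φ hφ hc, mul_sub]

theorem contDiff_shift (h : E d) {φ : E d → ℝ} (hφ : ContDiff ℝ ∞ φ) : ContDiff ℝ ∞ (shift h φ) :=
  hφ.comp (contDiff_id.add contDiff_const)

theorem hasCompactSupport_shift (h : E d) {φ : E d → ℝ} (hφ : HasCompactSupport φ) :
    HasCompactSupport (shift h φ) :=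
  hφ.comp_homeomorph (Homeomorph.addRight h)

theorem integral_shift_mul (h : E d) (u φ : E d → ℝ) :
    ∫ x, shift h u x * φ x = ∫ x, u x * shift (-h) φ x := by
  rw [← integral_add_right_eq_self (fun x => u x * shift (-h) φ x) h]
  simp [shift]

theorem locallyIntegrable_shift {u : E d → ℝ} (hu : LocallyIntegrable u volume) (h : E d) :
    LocallyIntegrable (shift h u) volume := by
  have h1 := (locallyIntegrable_map_homeomorph (Homeomorph.addRight h) (f := u)
    (μ := (volume : Measure (E d)))).1
  rw [Homeomorph.coe_addRight, map_add_right_eq_self] at h1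
  exact h1 hu

theorem HasWeakDeriv.shift {α : Fin d → ℕ} {u g : E d → ℝ} (hu : HasWeakDeriv α u g) (h : E d) :
    HasWeakDeriv α (shift h u) (shift h g) := by
  refine ⟨locallyIntegrable_shift hu.1 h, locallyIntegrable_shift hu.2.1 h, fun φ hφ hc => ?_⟩
  rw [integral_shift_mul, integral_shift_mul, ← multiDeriv_shift]
  exact hu.2.2 _ (contDiff_shift _ hφ) (hasCompactSupport_shift _ hc)

theorem HasWeakDeriv.integral_mul_partialDeriv {i : Fin d} {u g : E d → ℝ}
    (hu : HasWeakDeriv (Pi.single i 1) u g) {φ : E d → ℝ} (hφ : ContDiff ℝ ∞ φ)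
    (hc : HasCompactSupport φ) : ∫ x, u x * partialDeriv i φ x = -∫ x, g x * φ x := by
  have h := hu.2.2 φ hφ hc
  rw [multiDeriv_single, Finset.sum_pi_single'] at h
  simpa using h

/-! ### First differences of functions with square integrable gradient -/

open scoped Convolution in
-- The integral is a convolution, so the derivative falls on `ψ` and local integrability of `u`
-- suffices.
theorem hasFDerivAt_integral_mul_sub {u ψ : E d → ℝ} (hu : LocallyIntegrable u volume)
    (hψ : ContDiff ℝ ∞ ψ) (hc : HasCompactSupport ψ) (z : E d) :
    ∃ L : E d →L[ℝ] ℝ, HasFDerivAt (fun z => ∫ y, u y * ψ (z - y)) L z ∧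
      ∀ v, L v = ∫ y, u y * fderiv ℝ ψ (z - y) v := by
  have h := hc.hasFDerivAt_convolution_right (ContinuousLinearMap.mul ℝ ℝ) hu
    (hψ.of_le (by simp)) z
  refine ⟨_, h, fun v => ?_⟩
  rw [convolution_precompR_apply _ hu (hc.fderiv ℝ) (hψ.continuous_fderiv (by simp))]
  rfl

/-- By duality it suffices to pair with a test function `φ`. Moving the translation onto `φ` makes
the pairing differentiable along `t • h`; the weak derivative and Cauchy–Schwarz bound its
directional derivatives, and the mean value inequality concludes. The factor `d` comes from bounding
each coordinate of `h` by `‖h‖`. -/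
theorem eLpNorm_shift_sub_le_of_hasWeakDeriv {u : E d → ℝ} {g : Fin d → E d → ℝ}
    (hu : MemLp u 2 volume) (hg : ∀ i, HasWeakDeriv (Pi.single i 1) u (g i))
    (hg2 : ∀ i, MemLp (g i) 2 volume) {M : ℝ} (hM : 0 ≤ M)
    (hgM : ∀ i, eLpNorm (g i) 2 volume ≤ ENNReal.ofReal M) (h : E d) :
    eLpNorm (shift h u - u) 2 volume ≤ ENNReal.ofReal (d * ‖h‖ * M) := by
  refine eLpNorm_le_of_forall_contDiff_integral_mul_le ((memLp_shift hu h).sub hu)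
    (by positivity) fun φ hφ hc => ?_
  have hloc : LocallyIntegrable u volume := hu.locallyIntegrable (by norm_num)
  set N := (eLpNorm φ 2 volume).toReal with hN
  have hN0 : 0 ≤ N := ENNReal.toReal_nonneg
  have hφ2 : MemLp φ 2 volume := hφ.continuous.memLp_of_hasCompactSupport hc
  -- Reflecting `φ` turns the pairing with its translates into a convolution.
  have hψ : ContDiff ℝ ∞ (fun x => φ (-x)) := hφ.comp contDiff_neg
  have hψc : HasCompactSupport (fun x => φ (-x)) := hc.comp_homeomorph (Homeomorph.neg (E d))
  choose L hL hLv using hasFDerivAt_integral_mul_sub hloc hψ hψc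
  have hLi : ∀ z i, |L z (EuclideanSpace.single i 1)| ≤ M * N := by
    intro z i
    have e : ∀ y, fderiv ℝ (fun x => φ (-x)) (z - y) (EuclideanSpace.single i 1)
        = -partialDeriv i (shift (-z) φ) y := by
      intro y
      rw [partialDeriv_shift]
      simp only [shift, partialDeriv]
      have hd : HasFDerivAt φ (fderiv ℝ φ (-(z - y))) (-(z - y)) :=
        (hφ.differentiable (by simp) _).hasFDerivAt
      have hn : HasFDerivAt (fun x : E d => -x) (-ContinuousLinearMap.id ℝ (E d)) (z - y) :=
        (hasFDerivAt_id _).neg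
      rw [show (fun x => φ (-x)) = φ ∘ Neg.neg from rfl, (hd.comp (z - y) hn).fderiv, neg_sub,
        sub_eq_add_neg]
      simp
    rw [hLv]
    simp only [e, mul_neg, integral_neg]
    rw [(hg i).integral_mul_partialDeriv (contDiff_shift _ hφ) (hasCompactSupport_shift _ hc),
      neg_neg]
    refine (abs_integral_mul_le_eLpNorm_mul_eLpNorm (hg2 i) (memLp_shift hφ2 _)).trans ?_
    rw [eLpNorm_shift hφ2.1]
    exact mul_le_mul_of_nonneg_right (ENNReal.toReal_le_of_le_ofReal hM (hgM i)) hN0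
  have hLh : ∀ z, |L z h| ≤ d * ‖h‖ * M * N := by
    intro z
    have hsum : h = ∑ i, h i • (EuclideanSpace.single i (1 : ℝ) : E d) := by
      have := (EuclideanSpace.basisFun (Fin d) ℝ).sum_repr h
      simpa using this.symm
    have : L z h = ∑ i, h i * L z (EuclideanSpace.single i 1) := by
      conv_lhs => rw [hsum]
      simp
    rw [this]
    refine (Finset.abs_sum_le_sum_abs _ _).trans ?_
    have hb : ∀ i ∈ Finset.univ, |h i * L z (EuclideanSpace.single i 1)| ≤ ‖h‖ * (M * N) := by
      intro i _
      rw [abs_mul]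
      exact mul_le_mul (PiLp.norm_apply_le h i) (hLi z i) (abs_nonneg _) (norm_nonneg _)
    refine (Finset.sum_le_sum hb).trans (le_of_eq ?_)
    simp
    ring
  have hmv := norm_image_sub_le_of_norm_deriv_le_segment_01'
    (f := fun t : ℝ => ∫ y, u y * φ (-(t • h - y))) (f' := fun t => L (t • h) h)
    (C := d * ‖h‖ * M * N)
    (fun t _ => by
      have h1 : HasDerivAt (fun t : ℝ => t • h) h t := by
        simpa using (hasDerivAt_id t).smul_const h
      exact ((hL (t • h)).comp_hasDerivAt t h1).hasDerivWithinAt) (fun t _ => hLh _)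
  have e1 : ∫ y, u y * φ (-((1 : ℝ) • h - y)) = ∫ x, shift h u x * φ x := by
    rw [integral_shift_mul]
    simp [shift, sub_eq_add_neg]
  have e0 : ∫ y, u y * φ (-((0 : ℝ) • h - y)) = ∫ x, u x * φ x := by simp
  simp only [e1, e0] at hmv
  have e2 : ∫ x, (shift h u - u) x * φ x = (∫ x, shift h u x * φ x) - ∫ x, u x * φ x := by
    simp only [Pi.sub_apply, sub_mul]
    exact integral_sub (integrable_mul_of_hasCompactSupport (locallyIntegrable_shift hloc h)
      hφ.continuous hc) (integrable_mul_of_hasCompactSupport hloc hφ.continuous hc)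
  rw [e2]
  exact hmv

/-! ### The norms in terms of representatives -/

theorem eLpNorm_weakDeriv_le_sobolevNorm {k : ℕ} {α : Fin d → ℕ} (hα : ∑ i, α i ≤ k)
    (u : E d → ℝ) : eLpNorm (weakDeriv α u) 2 volume ≤ sobolevNorm k 2 u := by
  rw [sobolevNorm, if_neg (by norm_num), one_div, ENNReal.le_rpow_inv_iff (by norm_num)]
  have h1 : ∑ i, α i ∈ Finset.range (k + 1) := Finset.mem_range.2 (by omega)
  have h2 : α ∈ Finset.piAntidiag (Finset.univ : Finset (Fin d)) (∑ i, α i) := by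
    simp [Finset.mem_piAntidiag]
  refine le_trans ?_ (Finset.single_le_sum (fun _ _ => zero_le) h1)
  exact Finset.single_le_sum
    (f := fun α => eLpNorm (weakDeriv α u) 2 volume ^ (2 : ℝ≥0∞).toReal) (fun _ _ => zero_le) h2

theorem sobolevNorm_zero {u : E d → ℝ} (hu : MemLp u 2 volume) :
    sobolevNorm 0 2 u = eLpNorm u 2 volume := by
  have h := (hasWeakDeriv_zero (hu.locallyIntegrable (by norm_num))).weakDeriv_ae_eq
  rw [sobolevNorm, if_neg (by norm_num), zero_add, Finset.sum_range_one,
    Finset.piAntidiag_zero, Finset.sum_singleton, eLpNorm_congr_ae h, one_div,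
    ENNReal.rpow_rpow_inv (by norm_num)]

theorem memSobolev_zero {u : E d → ℝ} (hu : MemLp u 2 volume) : MemSobolev 0 2 u := by
  refine ⟨hu, fun α hα => ⟨u, ?_, hu⟩⟩
  have h0 : α = 0 := by
    funext i
    simpa using (Finset.sum_eq_zero_iff.1 (Nat.le_zero.1 hα)) i (Finset.mem_univ i)
  rw [h0]
  exact hasWeakDeriv_zero (hu.locallyIntegrable (by norm_num))

theorem eLpNorm_shift_sub_le_nikolskiiSeminorm {k : ℕ} {γ : ℝ} (hγ : γ ≠ 1) {α : Fin d → ℕ}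
    (hα : ∑ i, α i = k) {u g : E d → ℝ} (hg : HasWeakDeriv α u g) (h : E d) :
    eLpNorm (shift h g - g) 2 volume ≤
      ENNReal.ofReal (‖h‖ ^ γ) * nikolskiiSeminorm k γ 2 u := by
  rcases eq_or_ne h 0 with rfl | hh
  -- The seminorm says nothing about `h = 0`, but the left side vanishes there.
  · have : shift 0 g - g = 0 := by
      funext x
      simp [shift]
    simp [this]
  have hpos : 0 < ‖h‖ ^ γ := Real.rpow_pos_of_pos (norm_pos_iff.2 hh) _
  have hae := hg.weakDeriv_ae_eq
  rw [← eLpNorm_congr_ae ((shift_ae_eq hae h).sub hae), mul_comm,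
    ← ENNReal.div_le_iff (ENNReal.ofReal_pos.2 hpos).ne' ENNReal.ofReal_ne_top,
    nikolskiiSeminorm, if_neg hγ]
  exact le_iSup₂_of_le α hα (le_iSup₂_of_le h hh le_rfl)

/-- Bounds on `v` and its first differences give a bound on the norm of `N^γ_2(ℝ^d)`. -/
theorem memNikolskii_zero_of_le {γ A B : ℝ} (hγ : γ ≠ 1) (hA : 0 ≤ A) (hB : 0 ≤ B)
    {v : E d → ℝ} (hv : MemLp v 2 volume) (h1 : eLpNorm v 2 volume ≤ ENNReal.ofReal A)
    (h2 : ∀ k : E d, k ≠ 0 →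
      eLpNorm (shift k v - v) 2 volume ≤ ENNReal.ofReal (B * ‖k‖ ^ γ)) :
    MemNikolskii 0 γ 2 v ∧ nikolskiiNorm 0 γ 2 v ≤ ENNReal.ofReal (A + B) := by
  have hle : nikolskiiNorm 0 γ 2 v ≤ ENNReal.ofReal (A + B) := by
    rw [nikolskiiNorm, sobolevNorm_zero hv, ENNReal.ofReal_add hA hB]
    refine add_le_add h1 ?_
    rw [nikolskiiSeminorm, if_neg hγ]
    refine iSup₂_le fun α hα => iSup₂_le fun k hk => ?_
    have hpos : 0 < ‖k‖ ^ γ := Real.rpow_pos_of_pos (norm_pos_iff.2 hk) _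
    have h0 : α = 0 := by
      funext i
      simpa using (Finset.sum_eq_zero_iff.1 hα) i (Finset.mem_univ i)
    have hae := (hasWeakDeriv_zero (hv.locallyIntegrable (by norm_num))).weakDeriv_ae_eq
    rw [h0, eLpNorm_congr_ae ((shift_ae_eq hae k).sub hae),
      ENNReal.div_le_iff (ENNReal.ofReal_pos.2 hpos).ne' ENNReal.ofReal_ne_top,
      ← ENNReal.ofReal_mul hB]
    exact h2 k hk
  exact ⟨⟨memSobolev_zero hv, hle.trans_lt ENNReal.ofReal_lt_top⟩, hle⟩

/-! ### Differences of differences -/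

theorem eLpNorm_sub_shift_le {v : E d → ℝ} (hv : MemLp v 2 volume) {A : ℝ} (hA : 0 ≤ A)
    (h1 : eLpNorm v 2 volume ≤ ENNReal.ofReal A) (h : E d) :
    eLpNorm (v - shift h v) 2 volume ≤ ENNReal.ofReal (2 * A) := by
  refine (eLpNorm_sub_le hv.1 (memLp_shift hv h).1 (by norm_num)).trans ?_
  rw [eLpNorm_shift hv.1, two_mul, ENNReal.ofReal_add hA hA]
  exact add_le_add h1 h1

theorem shift_sub_shift_sub (u : E d → ℝ) (h k : E d) :
    shift k (u - shift h u) - (u - shift h u)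
      = (shift k u - u) - shift h (shift k u - u) := by
  funext x
  simp only [shift, Pi.sub_apply, add_right_comm x k h]
  ring

/-- For `r ≤ 1` the exponent `b` may be lowered to `a`; for `r ≥ 1` the trivial bound wins because
`r ^ a ≥ 1`. -/
theorem le_ofReal_rpow_of_le {X : ℝ≥0∞} {K N r a b : ℝ} (hK : 0 ≤ K) (hN : 0 ≤ N) (hr : 0 ≤ r)
    (ha : 0 < a) (hab : a ≤ b) (h1 : X ≤ ENNReal.ofReal (K * r ^ b * N))
    (h2 : X ≤ ENNReal.ofReal (2 * N)) : X ≤ ENNReal.ofReal ((2 + K) * r ^ a * N) := by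
  have hra : 0 ≤ r ^ a := Real.rpow_nonneg hr a
  rcases le_total r 1 with h | h
  · refine h1.trans (ENNReal.ofReal_le_ofReal ?_)
    have := Real.rpow_le_rpow_of_exponent_ge' hr h ha.le hab
    gcongr
    linarith
  · refine h2.trans (ENNReal.ofReal_le_ofReal ?_)
    have := Real.one_le_rpow h ha.le
    nlinarith [mul_nonneg hK hra]

theorem memNikolskii_sub_shift {γ₁ γ₂ K N : ℝ} (h₀ : 0 < γ₁) (h₁₂ : γ₁ < γ₂) (h₂ : γ₂ ≤ 1)
    (hK : 0 ≤ K) (hN : 0 ≤ N) {u : E d → ℝ} (hu : MemLp u 2 volume)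
    (huN : eLpNorm u 2 volume ≤ ENNReal.ofReal N)
    (hd : ∀ h : E d, eLpNorm (shift h u - u) 2 volume ≤ ENNReal.ofReal (K * ‖h‖ ^ γ₂ * N))
    (h : E d) :
    MemNikolskii 0 γ₁ 2 (u - shift h u) ∧
      nikolskiiNorm 0 γ₁ 2 (u - shift h u) ≤
        ENNReal.ofReal ((2 + 3 * K) * ‖h‖ ^ (γ₂ - γ₁)) * ENNReal.ofReal N := by
  have hv : MemLp (u - shift h u) 2 volume := hu.sub (memLp_shift hu h)
  have hvd : eLpNorm (u - shift h u) 2 volume ≤ ENNReal.ofReal (K * ‖h‖ ^ γ₂ * N) := by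
    rw [eLpNorm_sub_comm]
    exact hd h
  have hr : 0 ≤ ‖h‖ ^ (γ₂ - γ₁) := by positivity
  have hv1 := le_ofReal_rpow_of_le hK hN (norm_nonneg h) (sub_pos.2 h₁₂) (by linarith) hvd
    (eLpNorm_sub_shift_le hu hN huN h)
  -- `2 + K` pays for the `L₂` norm, `2 * K` for the seminorm.
  rw [← ENNReal.ofReal_mul (by positivity),
    show (2 + 3 * K) * ‖h‖ ^ (γ₂ - γ₁) * N
      = (2 + K) * ‖h‖ ^ (γ₂ - γ₁) * N + 2 * K * ‖h‖ ^ (γ₂ - γ₁) * N by ring]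
  refine memNikolskii_zero_of_le (by linarith) (by positivity) (by positivity) hv hv1
    fun k hk => ?_
  have split : ∀ x : ℝ, 0 ≤ x → x ^ γ₂ = x ^ (γ₂ - γ₁) * x ^ γ₁ := fun x hx => by
    rw [← Real.rpow_add_of_nonneg hx (by linarith) h₀.le, sub_add_cancel]
  rcases le_total ‖k‖ ‖h‖ with hkh | hkh
  -- Short `k`: use the regularity in `k` and the triangle inequality in `h`. For long `k` the roles
  -- are reversed.
  · rw [shift_sub_shift_sub]
    refine (eLpNorm_sub_shift_le ((memLp_shift hu k).sub hu) (by positivity) (hd k) h).trans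
      (ENNReal.ofReal_le_ofReal ?_)
    have := Real.rpow_le_rpow (norm_nonneg k) hkh (sub_pos.2 h₁₂).le
    calc 2 * (K * ‖k‖ ^ γ₂ * N) = 2 * K * ‖k‖ ^ (γ₂ - γ₁) * N * ‖k‖ ^ γ₁ := by
          rw [split _ (norm_nonneg k)]; ring
      _ ≤ _ := by gcongr
  · rw [eLpNorm_sub_comm]
    refine (eLpNorm_sub_shift_le hv (by positivity) hvd k).trans (ENNReal.ofReal_le_ofReal ?_)
    have := Real.rpow_le_rpow (norm_nonneg h) hkh h₀.le
    calc 2 * (K * ‖h‖ ^ γ₂ * N) = 2 * K * ‖h‖ ^ (γ₂ - γ₁) * N * ‖h‖ ^ γ₁ := by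
          rw [split _ (norm_nonneg h)]; ring
      _ ≤ _ := by gcongr

/-- A function in `W^1_2(ℝ^d)` has square integrable weak gradient, bounded by its norm. -/
theorem MemSobolev.exists_gradient {u : E d → ℝ} (hu : MemSobolev 1 2 u) :
    ∃ g : Fin d → E d → ℝ, (∀ i, HasWeakDeriv (Pi.single i 1) u (g i)) ∧
      (∀ i, MemLp (g i) 2 volume) ∧ ∀ i, eLpNorm (g i) 2 volume ≤ sobolevNorm 1 2 u := by
  have hs : ∀ i : Fin d, ∑ j, (Pi.single i 1 : Fin d → ℕ) j ≤ 1 := fun i => by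
    simp
  choose g hg hg2 using fun i => hu.2 (Pi.single i 1) (hs i)
  refine ⟨g, hg, hg2, fun i => ?_⟩
  rw [← eLpNorm_congr_ae (hg i).weakDeriv_ae_eq]
  exact eLpNorm_weakDeriv_le_sobolevNorm (hs i) u

theorem MemSobolev.eLpNorm_le {k : ℕ} {u : E d → ℝ} (hu : MemSobolev k 2 u) :
    eLpNorm u 2 volume ≤ sobolevNorm k 2 u := by
  rw [← eLpNorm_congr_ae
    (hasWeakDeriv_zero (hu.1.locallyIntegrable (by norm_num))).weakDeriv_ae_eq]
  exact eLpNorm_weakDeriv_le_sobolevNorm (by simp) u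

theorem MemSobolev.sobolevNorm_ne_top {k : ℕ} {u : E d → ℝ} (hu : MemSobolev k 2 u) :
    sobolevNorm k 2 u ≠ ⊤ := by
  rw [sobolevNorm, if_neg (by norm_num)]
  refine ENNReal.rpow_ne_top_of_nonneg (by positivity) (ENNReal.sum_ne_top.2 fun j hj =>
    ENNReal.sum_ne_top.2 fun α hα => ENNReal.rpow_ne_top_of_nonneg (by positivity) ?_)
  have hαj : ∑ i, α i = j := (Finset.mem_piAntidiag.1 hα).1
  obtain ⟨g, hg, hg2⟩ := hu.2 α (by have := Finset.mem_range.1 hj; omega)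
  rw [eLpNorm_congr_ae hg.weakDeriv_ae_eq]
  exact hg2.eLpNorm_ne_top

theorem memNikolskii_sub_shift_of_gradient {γ₁ γ₂ N : ℝ} (h₁ : 0 < γ₁) (h₂ : 0 < γ₂)
    (h₁₂ : γ₁ + γ₂ ≤ 1) (hN : 0 ≤ N) {u : E d → ℝ} (hu : MemLp u 2 volume)
    (huN : eLpNorm u 2 volume ≤ ENNReal.ofReal N) {g : Fin d → E d → ℝ}
    (hg : ∀ i, HasWeakDeriv (Pi.single i 1) u (g i)) (hg2 : ∀ i, MemLp (g i) 2 volume)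
    (hgN : ∀ i, eLpNorm (g i) 2 volume ≤ ENNReal.ofReal N)
    (hgd : ∀ i h, eLpNorm (shift h (g i) - g i) 2 volume ≤ ENNReal.ofReal (‖h‖ ^ γ₂ * N))
    (h : E d) :
    MemNikolskii 0 (1 - γ₁) 2 (u - shift h u) ∧
      nikolskiiNorm 0 (1 - γ₁) 2 (u - shift h u) ≤
        ENNReal.ofReal ((2 + 2 * d) * ‖h‖ ^ (γ₁ + γ₂)) * ENNReal.ofReal N := by
  have hv : MemLp (u - shift h u) 2 volume := hu.sub (memLp_shift hu h)
  have hvd : eLpNorm (u - shift h u) 2 volume ≤ ENNReal.ofReal (d * ‖h‖ ^ (1 : ℝ) * N) := by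
    rw [eLpNorm_sub_comm, Real.rpow_one]
    exact eLpNorm_shift_sub_le_of_hasWeakDeriv hu hg hg2 hN hgN h
  have hv1 := le_ofReal_rpow_of_le (Nat.cast_nonneg d) hN (norm_nonneg h)
    (add_pos h₁ h₂) h₁₂ hvd (eLpNorm_sub_shift_le hu hN huN h)
  -- the increment by `y` of the increment by `x`
  have hmix : ∀ x y : E d, eLpNorm (shift y (u - shift x u) - (u - shift x u)) 2 volume ≤
      ENNReal.ofReal (d * ‖y‖ * (‖x‖ ^ γ₂ * N)) := fun x y => by
    refine eLpNorm_shift_sub_le_of_hasWeakDeriv (hu.sub (memLp_shift hu x))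
      (fun i => (hg i).sub ((hg i).shift x)) (fun i => (hg2 i).sub (memLp_shift (hg2 i) x))
      (by positivity) (fun i => ?_) y
    rw [eLpNorm_sub_comm]
    exact hgd i x
  rw [← ENNReal.ofReal_mul (by positivity),
    show (2 + 2 * (d : ℝ)) * ‖h‖ ^ (γ₁ + γ₂) * N
      = (2 + d) * ‖h‖ ^ (γ₁ + γ₂) * N + d * ‖h‖ ^ (γ₁ + γ₂) * N by ring]
  refine memNikolskii_zero_of_le (by linarith) (by positivity) (by positivity) hv hv1
    fun k hk => ?_
  rcases le_total ‖k‖ ‖h‖ with hkh | hkh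
  · refine (hmix h k).trans (ENNReal.ofReal_le_ofReal ?_)
    have e : ‖k‖ = ‖k‖ ^ γ₁ * ‖k‖ ^ (1 - γ₁) := by
      rw [← Real.rpow_add_of_nonneg (norm_nonneg k) h₁.le (by linarith), add_sub_cancel,
        Real.rpow_one]
    have := Real.rpow_le_rpow (norm_nonneg k) hkh h₁.le
    calc d * ‖k‖ * (‖h‖ ^ γ₂ * N)
        = d * (‖k‖ ^ γ₁ * ‖h‖ ^ γ₂) * N * ‖k‖ ^ (1 - γ₁) := by
          conv_lhs => rw [e]
          ring
      _ ≤ d * (‖h‖ ^ γ₁ * ‖h‖ ^ γ₂) * N * ‖k‖ ^ (1 - γ₁) := by gcongr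
      _ = _ := by rw [← Real.rpow_add_of_nonneg (norm_nonneg h) h₁.le h₂.le]
  -- For long `k`, swapping the increments puts the full power `1` on `‖h‖`; the surplus exponent `1
  -- - γ₁ - γ₂ ≥ 0` is then traded for `‖k‖`.
  · have hsymm : shift k (u - shift h u) - (u - shift h u)
        = shift h (u - shift k u) - (u - shift k u) := by
      rw [shift_sub_shift_sub]
      funext x
      simp only [shift, Pi.sub_apply]
      ring
    rw [hsymm]
    refine (hmix k h).trans (ENNReal.ofReal_le_ofReal ?_)
    have e : ‖h‖ = ‖h‖ ^ (γ₁ + γ₂) * ‖h‖ ^ (1 - γ₁ - γ₂) := by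
      rw [← Real.rpow_add_of_nonneg (norm_nonneg h) (by linarith) (by linarith),
        show γ₁ + γ₂ + (1 - γ₁ - γ₂) = 1 by ring, Real.rpow_one]
    have := Real.rpow_le_rpow (norm_nonneg h) hkh (show 0 ≤ 1 - γ₁ - γ₂ by linarith)
    calc d * ‖h‖ * (‖k‖ ^ γ₂ * N)
        = d * ‖h‖ ^ (γ₁ + γ₂) * N * (‖h‖ ^ (1 - γ₁ - γ₂) * ‖k‖ ^ γ₂) := by
          conv_lhs => rw [e]
          ring
      _ ≤ d * ‖h‖ ^ (γ₁ + γ₂) * N * (‖k‖ ^ (1 - γ₁ - γ₂) * ‖k‖ ^ γ₂) := by gcongr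
      _ = _ := by
        rw [← Real.rpow_add_of_nonneg (norm_nonneg k) (by linarith) h₂.le, sub_add_cancel]

end Nikolskii

end

/-! ### ### The three estimates -/

open Nikolskii in
theorem mainTheorem8 (d : ℕ) :
    (∀ γ₁ γ₂ : ℝ, 0 < γ₁ → γ₁ < γ₂ → γ₂ < 1 →
      ∃ C : ℝ, 0 < C ∧ ∀ u : Nikolskii.E d → ℝ, Nikolskii.MemNikolskii 0 γ₂ 2 u →
        ∀ h : Nikolskii.E d,
          Nikolskii.MemNikolskii 0 γ₁ 2 (u - Nikolskii.shift h u) ∧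
          Nikolskii.nikolskiiNorm 0 γ₁ 2 (u - Nikolskii.shift h u) ≤
            ENNReal.ofReal (C * ‖h‖ ^ (γ₂ - γ₁)) * Nikolskii.nikolskiiNorm 0 γ₂ 2 u) ∧
    (∀ γ₁ : ℝ, 0 < γ₁ → γ₁ < 1 →
      ∃ C : ℝ, 0 < C ∧ ∀ u : Nikolskii.E d → ℝ, Nikolskii.MemSobolev 1 2 u →
        ∀ h : Nikolskii.E d,
          Nikolskii.MemNikolskii 0 γ₁ 2 (u - Nikolskii.shift h u) ∧
          Nikolskii.nikolskiiNorm 0 γ₁ 2 (u - Nikolskii.shift h u) ≤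
            ENNReal.ofReal (C * ‖h‖ ^ (1 - γ₁)) * Nikolskii.sobolevNorm 1 2 u) ∧
    (∀ γ₁ γ₂ : ℝ, 0 < γ₁ → γ₁ < γ₁ + γ₂ → γ₁ + γ₂ ≤ 1 →
      ∃ C : ℝ, 0 < C ∧ ∀ u : Nikolskii.E d → ℝ, Nikolskii.MemNikolskii 1 γ₂ 2 u →
        ∀ h : Nikolskii.E d,
          Nikolskii.MemNikolskii 0 (1 - γ₁) 2 (u - Nikolskii.shift h u) ∧
          Nikolskii.nikolskiiNorm 0 (1 - γ₁) 2 (u - Nikolskii.shift h u) ≤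
            ENNReal.ofReal (C * ‖h‖ ^ (γ₁ + γ₂)) * Nikolskii.nikolskiiNorm 1 γ₂ 2 u) := by
  refine ⟨fun γ₁ γ₂ h₀ h₁₂ h₂ => ⟨2 + 3 * 1, by norm_num, fun u hu h => ?_⟩,
    fun γ₁ h₀ h₁ => ⟨2 + 3 * d, by positivity, fun u hu h => ?_⟩,
    fun γ₁ γ₂ h₀ h₁₂ h₂ => ⟨2 + 2 * d, by positivity, fun u hu h => ?_⟩⟩
  · have hN := ENNReal.ofReal_toReal hu.2.ne
    rw [← hN]
    refine memNikolskii_sub_shift h₀ h₁₂ h₂.le zero_le_one ENNReal.toReal_nonneg hu.1.1 ?_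
      (fun k => ?_) h
    · rw [hN]
      exact hu.1.eLpNorm_le.trans le_self_add
    · rw [one_mul, ENNReal.ofReal_mul (by positivity), hN]
      refine (eLpNorm_shift_sub_le_nikolskiiSeminorm (k := 0) h₂.ne (by simp)
        (hasWeakDeriv_zero (hu.1.1.locallyIntegrable (by norm_num))) k).trans ?_
      gcongr
      exact le_add_self
  · have hN := ENNReal.ofReal_toReal hu.sobolevNorm_ne_top
    obtain ⟨g, hg, hg2, hgN⟩ := hu.exists_gradient
    rw [← hN]
    refine memNikolskii_sub_shift h₀ h₁ le_rfl (Nat.cast_nonneg d) ENNReal.toReal_nonneg hu.1 ?_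
      (fun k => ?_) h
    · rw [hN]
      exact hu.eLpNorm_le
    · rw [Real.rpow_one]
      exact eLpNorm_shift_sub_le_of_hasWeakDeriv hu.1 hg hg2 ENNReal.toReal_nonneg
        (fun i => (hgN i).trans hN.ge) k
  · have hN := ENNReal.ofReal_toReal hu.2.ne
    obtain ⟨g, hg, hg2, hgN⟩ := hu.1.exists_gradient
    rw [← hN]
    refine memNikolskii_sub_shift_of_gradient h₀ (by linarith) h₂ ENNReal.toReal_nonneg hu.1.1
      ?_ hg hg2 (fun i => ?_) (fun i k => ?_) h
    · rw [hN]
      exact hu.1.eLpNorm_le.trans le_self_add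
    · rw [hN]
      exact (hgN i).trans le_self_add
    · rw [ENNReal.ofReal_mul (by positivity), hN]
      -- Here `γ₂ < 1` because `γ₁ > 0`, so the seminorm is the one with first differences.
      refine (eLpNorm_shift_sub_le_nikolskiiSeminorm (k := 1) (γ := γ₂) (by linarith) (by simp)
        (hg i) k).trans ?_
      gcongr
      exact le_add_self
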